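/- Let $I$ be an infinite set and, for each $i\in I$, let $A_i$ be a unital $^*$-algebra over $\mathbb{C}$, $H_i$ a complex Hilbert space and $\Psi_i:A_i\to\mathcal{L}(H_i)$ a unital $^*$-representation. Notation. For a family of complex vector spaces $(X_i)_{i\in I}$ let $\bigotimes_{i\in I}X_i$ be the algebraic tensor product that is universal for maps on $\prod_{i\in I}X_i$ that are linear in each variable; write $\otimes_i x_i$ for the image of $x=(x_i)_{i}$. Write $x\sim y$ if $x_i=y_i$ for all but finitely many $i$, and for a class $\omega$ of $\sim$ put $\bigotimes^{\omega}_{i\in I} X_i=\mathrm{span}\{\otimes_i x_i : x\sim u\}$, where $u$ is any representative of $\omega$. The space $\bigotimes_{i\in I}A_i$ is a unital $^*$-algebra under the coordinatewise operations on elementary tensors. Let $\Omega^{\rm ut}$ be the set of $\sim$-classes of families of unitary elements $u_i\in A_i$, let $\bigotimes^{\rm ut}_{i\in I}A_i=\sum_{\omega\in\Omega^{\rm ut}}\bigotimes^{\omega}_{i\in I}A_i$, and let $\bigotimes^{e}_{i\in I}A_i$ be the summand of the class of the family of identities; both are unital $^*$-subalgebras of $\bigotimes_{i\in I}A_i$.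 Let $\Omega^{\rm un}$ be the set of $\sim$-classes of families of unit vectors $x_i\in H_i$, and let $\bigotimes^{\rm un}_{i\in I}H_i$ be the span of all $\otimes_i x_i$ with $\|x_i\|=1$ for every $i$. It contains $\bigotimes^{\mu}_{i\in I}H_i$ for every $\mu\in\Omega^{\rm un}$, and it carries the inner product given by $$\langle\otimes_i x_i,\otimes_i y_i\rangle_{\phi_1}=\begin{cases}\prod_i\langle x_i,y_i\rangle & \text{if } \langle x_i,y_i\rangle=1 \text{ for all but finitely many } i,\\ 0 & \text{otherwise.}\end{cases}$$ Let $\bar\bigotimes^{\phi_1}_{i\in I}H_i$ and $\bar\bigotimes^{\mu}_{i\in I}H_i$ be the Hilbert space completions of $\bigotimes^{\rm un}_{i\in I}H_i$ and $\bigotimes^{\mu}_{i\in I}H_i$. Let $\Psi_0:\bigotimes_{i\in I}A_i\to L(\bigotimes_{i\in I}H_i)$ be the canonical map, $\Psi_0(\otimes_i a_i)(\otimes_i x_i)=\otimes_i\Psi_i(a_i)x_i$. Theorem. (a) For every $a\in\bigotimes^{\rm ut}_{i\in I}A_i$ the operator $\Psi_0(a)$ maps $\bigotimes^{\rm un}_{i\in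 I}H_i$ into itself, and there is a unique unital $^*$-representation $\bigotimes^{\phi_1}_{i\in I}\Psi_i:\bigotimes^{\rm ut}_{i\in I}A_i\to\mathcal{L}\big(\bar\bigotimes^{\phi_1}_{i\in I}H_i\big)$ such that $\big(\bigotimes^{\phi_1}_{i\in I}\Psi_i\big)(a)$ extends $\Psi_0(a)|_{\bigotimes^{\rm un}_{i\in I}H_i}$ for every such $a$. (b) For every $\mu\in\Omega^{\rm un}$ and $a\in\bigotimes^{e}_{i\in I}A_i$ the operator $\Psi_0(a)$ maps $\bigotimes^{\mu}_{i\in I}H_i$ into itself, and there is a unique unital $^*$-representation $\bigotimes^{\mu}_{i\in I}\Psi_i:\bigotimes^{e}_{i\in I}A_i\to\mathcal{L}\big(\bar\bigotimes^{\mu}_{i\in I}H_i\big)$ such that $\big(\bigotimes^{\mu}_{i\in I}\Psi_i\big)(a)$ extends $\Psi_0(a)|_{\bigotimes^{\mu}_{i\in I}H_i}$ for every such $a$. Moreover $$\Big(\bar\bigotimes^{\phi_1}_{i\in I}H_i,\ \big(\bigotimes^{\phi_1}_{i\in I}\Psi_i\big)\big|_{\bigotimes^{e}_{i\in I}A_i}\Big)=\bigoplus_{\mu\in\Omega^{\rm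 un}}\Big(\bar\bigotimes^{\mu}_{i\in I}H_i,\ \bigotimes^{\mu}_{i\in I}\Psi_i\Big),$$ that is, there is a unitary from the $\ell^2$-direct sum of the spaces $\bar\bigotimes^{\mu}_{i\in I}H_i$ onto $\bar\bigotimes^{\phi_1}_{i\in I}H_i$ which extends the inclusions $\bigotimes^{\mu}_{i\in I}H_i\subseteq\bigotimes^{\rm un}_{i\in I}H_i$ and which carries $\bigoplus_{\mu}\bigotimes^{\mu}_{i\in I}\Psi_i$ to the restriction of $\bigotimes^{\phi_1}_{i\in I}\Psi_i$ to $\bigotimes^{e}_{i\in I}A_i$. (c) If all $\Psi_i$ are injective, then $\bigotimes^{\phi_1}_{i\in I}\Psi_i$ is injective. -/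

import Mathlib

open Filter
open scoped TensorProduct

set_option linter.unusedSectionVars false

noncomputable section

namespace InfTensor

variable {I : Type*}

/-! ### Conjugate-linear maps out of a tensor product -/

section ConjLift

variable {X : I → Type*} [∀ i, AddCommGroup (X i)] [∀ i, Module ℂ (X i)]
  {E : Type*} [AddCommGroup E] [Module ℂ E]

/-- The conjugate-linear map on `⨂ X i` induced by a map that is conjugate-linear in each
variable. -/
def conjLift (f : (Π i, X i) → E)
    (hadd : ∀ [DecidableEq I] (m : Π i, X i) (i : I) (x y : X i),
      f (Function.update m i (x + y)) = f (Function.update m i x) + f (Function.update m i y))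
    (hsmul : ∀ [DecidableEq I] (m : Π i, X i) (i : I) (c : ℂ) (x : X i),
      f (Function.update m i (c • x)) = (starRingEnd ℂ c) • f (Function.update m i x)) :
    (⨂[ℂ] i, X i) →ₛₗ[starRingEnd ℂ] E :=
  let g : (⨂[ℂ] i, X i) →+ E := PiTensorProduct.liftAddHom
    (fun p => (starRingEnd ℂ p.1) • f p.2)
    (by
      classical
      intro r m i hi
      have h := hsmul m i 0 (m i)
      rw [zero_smul, map_zero, zero_smul, ← hi, Function.update_eq_self] at h
      rw [h, smul_zero])
    (by intro m; simp)
    (by intro _ r m i x y; simp only [hadd, smul_add])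
    (by intro r r' m; simp only [map_add, add_smul])
    (by
      intro _ r m i c
      simp only [hsmul, Function.update_eq_self, map_mul, smul_smul]
      rw [mul_comm])
  { g with
    map_smul' := by
      have key : ∀ (r : ℂ) (m : Π i, X i),
          g (r • PiTensorProduct.tprod ℂ m) = (starRingEnd ℂ r) • f m := by
        intro r m
        rw [← PiTensorProduct.tprodCoeff_eq_smul_tprod]
        rfl
      intro c x
      change g (c • x) = (starRingEnd ℂ c) • g x
      induction x using PiTensorProduct.induction_on with
      | smul_tprod r m => rw [smul_smul, key, key, map_mul, smul_smul]
      | add x y hx hy => rw [smul_add, map_add, map_add, hx, hy, smul_add] }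

theorem conjLift_tprod (f : (Π i, X i) → E) (hadd) (hsmul) (m : Π i, X i) :
    conjLift f hadd hsmul (PiTensorProduct.tprod ℂ m) = f m := by
  change (starRingEnd ℂ 1) • f m = f m
  simp

end ConjLift

/-! ### Classes modulo finite sets and the corresponding subspaces -/

section Classes

variable {X : I → Type*} [∀ i, AddCommGroup (X i)] [∀ i, Module ℂ (X i)]

/-- The set `∏ S i` modulo the relation `u ∼ v` iff `u i = v i` for all but finitely many `i`. -/
abbrev ClassSet (S : Π i, Set (X i)) := Filter.Product (cofinite : Filter I) (fun i => S i)

/-- `∏^ω X i`: the families `x ∈ ∏ X i` that agree, outside a finite set, with a representative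
of `ω`. -/
def classPi (S : Π i, Set (X i)) (ω : ClassSet S) : Set (Π i, X i) :=
  {x | ∃ u : Π i, S i, (u : ClassSet S) = ω ∧ ∀ᶠ i in cofinite, x i = u i}

/-- `⨂^ω X i`: the span of the elementary tensors of the elements of `∏^ω X i`. -/
def classSpan (S : Π i, Set (X i)) (ω : ClassSet S) : Submodule ℂ (⨂[ℂ] i, X i) :=
  Submodule.span ℂ (PiTensorProduct.tprod ℂ '' classPi S ω)

theorem iSup_classSpan (S : Π i, Set (X i)) :
    ⨆ ω, classSpan S ω = Submodule.span ℂ (PiTensorProduct.tprod ℂ ''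
      {x : Π i, X i | ∃ u : Π i, S i, ∀ᶠ i in cofinite, x i = u i}) := by
  simp only [classSpan]
  rw [Submodule.iSup_span, ← Set.image_iUnion]
  congr 2
  ext x
  simp only [classPi, Set.mem_iUnion, Set.mem_ofPred_eq]
  constructor
  · rintro ⟨ω, u, -, h⟩
    exact ⟨u, h⟩
  · rintro ⟨u, h⟩
    exact ⟨_, u, rfl, h⟩

end Classes

/-! ### Tensor products of unital `*`-algebras -/

section Algebras

variable {A : I → Type*} [∀ i, Ring (A i)] [∀ i, StarRing (A i)] [∀ i, Algebra ℂ (A i)]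
  [∀ i, StarModule ℂ (A i)]

/-- The involution `(⨂ a i)⋆ = ⨂ (a i)⋆`. -/
def starMap : (⨂[ℂ] i, A i) →ₛₗ[starRingEnd ℂ] (⨂[ℂ] i, A i) :=
  conjLift (fun a => PiTensorProduct.tprod ℂ (fun i => star (a i)))
    (by
      intro _ m i x y
      have h : ∀ z : A i, (fun j => star (Function.update m i z j)) =
          Function.update (fun j => star (m j)) i (star z) := by
        intro z; ext j; rcases eq_or_ne j i with rfl | hj <;> simp [*]
      simp only [h, star_add, MultilinearMap.map_update_add])
    (by
      intro _ m i c x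
      have h : ∀ z : A i, (fun j => star (Function.update m i z j)) =
          Function.update (fun j => star (m j)) i (star z) := by
        intro z; ext j; rcases eq_or_ne j i with rfl | hj <;> simp [*]
      simp only [h, star_smul, MultilinearMap.map_update_smul, RCLike.star_def])

theorem starMap_tprod (a : Π i, A i) :
    starMap (PiTensorProduct.tprod ℂ a) = PiTensorProduct.tprod ℂ (star a) :=
  conjLift_tprod _ _ _ _

instance instStarRingTensor : StarRing (⨂[ℂ] i, A i) where
  star := starMap
  star_involutive x := by
    change starMap (starMap x) = x
    induction x using PiTensorProduct.induction_on with
    | smul_tprod r m =>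
      rw [LinearMap.map_smulₛₗ, LinearMap.map_smulₛₗ, starMap_tprod, starMap_tprod, star_star]
      simp
    | add x y hx hy => rw [map_add, map_add, hx, hy]
  star_mul x y := by
    change starMap (x * y) = starMap y * starMap x
    induction x using PiTensorProduct.induction_on with
    | smul_tprod r m =>
      induction y using PiTensorProduct.induction_on with
      | smul_tprod s n =>
        simp only [LinearMap.map_smulₛₗ, starMap_tprod, smul_mul_smul_comm,
          PiTensorProduct.tprod_mul_tprod, star_mul, map_mul, mul_comm]
      | add x y hx hy => rw [mul_add, map_add, map_add, add_mul, hx, hy]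
    | add x y hx hy => rw [add_mul, map_add, map_add, mul_add, hx, hy]
  star_add x y := map_add starMap x y

theorem star_tprod (a : Π i, A i) :
    star (PiTensorProduct.tprod ℂ a) = PiTensorProduct.tprod ℂ (star a) :=
  starMap_tprod a

instance instStarModuleTensor : StarModule ℂ (⨂[ℂ] i, A i) where
  star_smul c x := LinearMap.map_smulₛₗ starMap c x

theorem span_mul_mem {T T' T'' : Set (Π i, A i)} (h : ∀ a ∈ T, ∀ b ∈ T', a * b ∈ T'')
    {x y : ⨂[ℂ] i, A i} (hx : x ∈ Submodule.span ℂ (PiTensorProduct.tprod ℂ '' T))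
    (hy : y ∈ Submodule.span ℂ (PiTensorProduct.tprod ℂ '' T')) :
    x * y ∈ Submodule.span ℂ (PiTensorProduct.tprod ℂ '' T'') := by
  have := Submodule.mul_mem_mul hx hy
  rw [Submodule.span_mul_span] at this
  refine Submodule.span_mono ?_ this
  rintro _ ⟨_, ⟨a, ha, rfl⟩, _, ⟨b, hb, rfl⟩, rfl⟩
  exact ⟨a * b, h a ha b hb, (PiTensorProduct.tprod_mul_tprod a b).symm⟩

theorem span_star_mem {T T' : Set (Π i, A i)} (h : ∀ a ∈ T, star a ∈ T')
    {x : ⨂[ℂ] i, A i} (hx : x ∈ Submodule.span ℂ (PiTensorProduct.tprod ℂ '' T)) :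
    star x ∈ Submodule.span ℂ (PiTensorProduct.tprod ℂ '' T') := by
  induction hx using Submodule.span_induction with
  | mem x hx =>
    obtain ⟨a, ha, rfl⟩ := hx
    rw [star_tprod]
    exact Submodule.subset_span ⟨_, h a ha, rfl⟩
  | zero => simp
  | add x y _ _ hx hy => rw [star_add]; exact add_mem hx hy
  | smul c x _ hx => rw [star_smul]; exact Submodule.smul_mem _ _ hx

variable (A) in
/-- The family of the unitary groups of the algebras `A i`. -/
def unitarySets : Π i, Set (A i) := fun i => (unitary (A i) : Set (A i))

variable (A) in
/-- `⨂^ut A i`: the sum of the subspaces `⨂^ω A i` over the classes `ω` of families of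
unitary elements. -/
def utAlg : StarSubalgebra ℂ (⨂[ℂ] i, A i) where
  carrier := (⨆ ω : ClassSet (unitarySets A), classSpan (unitarySets A) ω :
    Submodule ℂ (⨂[ℂ] i, A i))
  add_mem' := add_mem
  zero_mem' := zero_mem _
  algebraMap_mem' r := by
    rw [Algebra.algebraMap_eq_smul_one, iSup_classSpan]
    exact Submodule.smul_mem _ _ (Submodule.subset_span
      ⟨1, ⟨fun i => ⟨1, one_mem (unitary (A i))⟩, by simp⟩, rfl⟩)
  mul_mem' {x y} hx hy := by
    rw [iSup_classSpan] at hx hy ⊢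
    refine span_mul_mem ?_ hx hy
    rintro a ⟨u, hu⟩ b ⟨v, hv⟩
    refine ⟨fun i => ⟨(u i : A i) * (v i : A i), (unitary (A i)).mul_mem (u i).2 (v i).2⟩, ?_⟩
    filter_upwards [hu, hv] with i h1 h2
    simp [h1, h2]
  star_mem' {x} hx := by
    rw [iSup_classSpan] at hx ⊢
    refine span_star_mem ?_ hx
    rintro a ⟨u, hu⟩
    refine ⟨fun i => ⟨star (u i : A i), Unitary.star_mem (u i).2⟩, ?_⟩
    filter_upwards [hu] with i h1
    simp [h1]

variable (A) in
/-- The class of the family of the identities. -/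
def oneClass : ClassSet (unitarySets A) :=
  ((fun i => ⟨1, one_mem (unitary (A i))⟩ : Π i, unitarySets A i) : ClassSet (unitarySets A))

theorem mem_classPi_oneClass (a : Π i, A i) :
    a ∈ classPi (unitarySets A) (oneClass A) ↔ ∀ᶠ i in cofinite, a i = 1 := by
  constructor
  · rintro ⟨u, hu, h⟩
    have hu' : ∀ᶠ i in cofinite, u i = ⟨1, one_mem (unitary (A i))⟩ := Quotient.exact hu
    filter_upwards [h, hu'] with i h1 h2
    rw [h1, h2]
  · intro h
    exact ⟨_, rfl, h⟩

variable (A) in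
/-- `⨂^e A i`: the subspace `⨂^ω A i` for the class `ω` of the family of the identities. -/
def eAlg : StarSubalgebra ℂ (⨂[ℂ] i, A i) where
  carrier := classSpan (unitarySets A) (oneClass A)
  add_mem' := add_mem
  zero_mem' := zero_mem _
  algebraMap_mem' r := by
    rw [Algebra.algebraMap_eq_smul_one]
    exact Submodule.smul_mem _ _ (Submodule.subset_span
      ⟨1, (mem_classPi_oneClass _).2 (by simp), rfl⟩)
  mul_mem' {x y} hx hy := by
    refine span_mul_mem ?_ hx hy
    intro a ha b hb
    rw [mem_classPi_oneClass] at *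
    filter_upwards [ha, hb] with i h1 h2
    simp [h1, h2]
  star_mem' {x} hx := by
    refine span_star_mem ?_ hx
    intro a ha
    rw [mem_classPi_oneClass] at *
    filter_upwards [ha] with i h1
    simp [h1]

variable (A) in
theorem eAlg_le_utAlg : eAlg A ≤ utAlg A :=
  fun _ hx => le_iSup (classSpan (unitarySets A)) (oneClass A) hx

end Algebras

/-! ### The functional `φ₁` and the form it induces -/

section Phi

variable (I) in
open Classical in
/-- The multilinear map that sends `β` to `∏ β i` if `β i = 1` for all but finitely many `i`,
and to `0` otherwise. -/
def varphiOne : MultilinearMap ℂ (fun _ : I => ℂ) ℂ :=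
  have key : ∀ [DecidableEq I] (m : I → ℂ) (i : I) (z : ℂ),
      (if ∀ᶠ j in cofinite, Function.update m i z j = 1 then ∏ᶠ j, Function.update m i z j
        else 0) =
      z * (if ∀ᶠ j in cofinite, m j = 1 then ∏ᶠ j, Function.update m i 1 j else 0) := by
    intro _ m i z
    have hne : ∀ᶠ j in cofinite, j ≠ i := by
      simp [Filter.eventually_cofinite]
    have hiff : ∀ w : ℂ, (∀ᶠ j in cofinite, Function.update m i w j = 1) ↔
        ∀ᶠ j in cofinite, m j = 1 := by
      intro w
      refine Filter.eventually_congr ?_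
      filter_upwards [hne] with j hj
      simp [hj]
    by_cases h : ∀ᶠ j in cofinite, m j = 1
    · rw [if_pos ((hiff z).2 h), if_pos h]
      have hs : (fun j => Function.update m i z j) =
          fun j => (Function.update (fun _ => (1 : ℂ)) i z j) * Function.update m i 1 j := by
        ext j
        rcases eq_or_ne j i with rfl | hj <;> simp [*]
      rw [hs, finprod_mul_distrib]
      · rw [finprod_eq_single _ i (by intro j hj; simp [hj])]
        simp
      · refine (Set.finite_singleton i).subset ?_
        intro j hj
        by_contra hji
        exact hj (by simp only [Set.mem_singleton_iff] at hji; simp [hji])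
      · exact Filter.eventually_cofinite.1 ((hiff 1).2 h)
    · rw [if_neg (fun h' => h ((hiff z).1 h')), if_neg h, mul_zero]
  { toFun := fun β => if ∀ᶠ i in cofinite, β i = 1 then ∏ᶠ i, β i else 0
    map_update_add' := by intro _ m i x y; rw [key, key, key, add_mul]
    map_update_smul' := by intro _ m i c x; rw [key, key, smul_eq_mul, smul_eq_mul, mul_assoc] }

variable (I) in
/-- The linear functional `φ₁` on `⨂ ℂ` induced by `varphiOne`. -/
def phiOne : (⨂[ℂ] _ : I, ℂ) →ₗ[ℂ] ℂ := PiTensorProduct.lift (varphiOne I)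

open Classical in
theorem phiOne_tprod (β : I → ℂ) : phiOne I (PiTensorProduct.tprod ℂ β) =
    if ∀ᶠ i in cofinite, β i = 1 then ∏ᶠ i, β i else 0 := by
  simp only [phiOne, PiTensorProduct.lift.tprod]
  rfl

variable {H : I → Type*} [∀ i, NormedAddCommGroup (H i)] [∀ i, InnerProductSpace ℂ (H i)]

variable (H) in
/-- The form `⟨⨂ x i, ⨂ y i⟩ = ⨂ ⟨x i, y i⟩` with values in `⨂ ℂ` (conjugate-linear in the first
variable, as is the convention for inner products here). -/
def tensorForm : (⨂[ℂ] i, H i) →ₛₗ[starRingEnd ℂ] (⨂[ℂ] i, H i) →ₗ[ℂ] (⨂[ℂ] _ : I, ℂ) :=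
  conjLift (fun x => PiTensorProduct.map (fun i => innerₛₗ ℂ (x i)))
    (by
      intro _ m i x y
      have h : ∀ z : H i, (fun j => innerₛₗ ℂ (Function.update m i z j)) =
          Function.update (fun j => innerₛₗ ℂ (m j)) i (innerₛₗ ℂ z) := by
        intro z; ext j; rcases eq_or_ne j i with rfl | hj <;> simp [*]
      simp only [h, map_add, PiTensorProduct.map_update_add])
    (by
      intro _ m i c x
      have h : ∀ z : H i, (fun j => innerₛₗ ℂ (Function.update m i z j)) =
          Function.update (fun j => innerₛₗ ℂ (m j)) i (innerₛₗ ℂ z) := by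
        intro z; ext j; rcases eq_or_ne j i with rfl | hj <;> simp [*]
      simp only [h, LinearMap.map_smulₛₗ, PiTensorProduct.map_update_smul])

theorem tensorForm_tprod (x y : Π i, H i) :
    tensorForm H (PiTensorProduct.tprod ℂ x) (PiTensorProduct.tprod ℂ y) =
      PiTensorProduct.tprod ℂ (fun i => inner ℂ (x i) (y i)) := by
  rw [tensorForm, conjLift_tprod, PiTensorProduct.map_tprod]
  rfl

/-- The form `⟨ξ, η⟩ = φ₁(⟨ξ, η⟩_{⨂ ℂ})`. -/
def phiForm (ξ η : ⨂[ℂ] i, H i) : ℂ := phiOne I (tensorForm H ξ η)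

open Classical in
theorem phiForm_tprod (x y : Π i, H i) :
    phiForm (PiTensorProduct.tprod ℂ x) (PiTensorProduct.tprod ℂ y) =
      if ∀ᶠ i in cofinite, inner ℂ (x i) (y i) = 1 then ∏ᶠ i, inner ℂ (x i) (y i) else 0 := by
  rw [phiForm, tensorForm_tprod, phiOne_tprod]

theorem phiForm_add_left (ξ ξ' η : ⨂[ℂ] i, H i) :
    phiForm (ξ + ξ') η = phiForm ξ η + phiForm ξ' η := by
  simp [phiForm]

theorem phiForm_add_right (ξ η η' : ⨂[ℂ] i, H i) :
    phiForm ξ (η + η') = phiForm ξ η + phiForm ξ η' := by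
  simp [phiForm]

theorem phiForm_smul_left (c : ℂ) (ξ η : ⨂[ℂ] i, H i) :
    phiForm (c • ξ) η = (starRingEnd ℂ c) * phiForm ξ η := by
  simp [phiForm, LinearMap.map_smulₛₗ]

theorem phiForm_smul_right (c : ℂ) (ξ η : ⨂[ℂ] i, H i) :
    phiForm ξ (c • η) = c * phiForm ξ η := by
  simp [phiForm]

theorem phiForm_conj_symm (ξ η : ⨂[ℂ] i, H i) :
    (starRingEnd ℂ) (phiForm η ξ) = phiForm ξ η := by
  induction ξ using PiTensorProduct.induction_on with
  | smul_tprod r x =>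
    induction η using PiTensorProduct.induction_on with
    | smul_tprod s y =>
      have h : (starRingEnd ℂ) (phiForm (PiTensorProduct.tprod ℂ y) (PiTensorProduct.tprod ℂ x)) =
          phiForm (PiTensorProduct.tprod ℂ x) (PiTensorProduct.tprod ℂ y) := by
        have h1 : ∀ i, (inner ℂ (y i) (x i) = 1) ↔ (inner ℂ (x i) (y i) = 1) := by
          intro i
          constructor
          · intro h
            rw [← inner_conj_symm, h, map_one]
          · intro h
            rw [← inner_conj_symm, h, map_one]
        rw [phiForm_tprod, phiForm_tprod]
        by_cases h2 : ∀ᶠ i in cofinite, inner ℂ (x i) (y i) = 1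
        · have h2' : ∀ᶠ i in cofinite, inner ℂ (y i) (x i) = 1 := h2.mono fun i hi => (h1 i).2 hi
          rw [if_pos h2, if_pos h2']
          have h3 : (Function.mulSupport fun i => inner ℂ (y i) (x i)).Finite :=
            Filter.eventually_cofinite.1 h2'
          have h4 := ((starRingEnd ℂ : ℂ →+* ℂ) : ℂ →* ℂ).map_finprod h3
          refine h4.trans (finprod_congr fun i => ?_)
          exact inner_conj_symm (x i) (y i)
        · have h2' : ¬ ∀ᶠ i in cofinite, inner ℂ (y i) (x i) = 1 :=
            fun h' => h2 (h'.mono fun i hi => (h1 i).1 hi)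
          rw [if_neg h2, if_neg h2', map_zero]
      simp only [phiForm_smul_left, phiForm_smul_right, map_mul, h, RCLike.conj_conj]
      ring
    | add x y hx hy => rw [phiForm_add_left, phiForm_add_right, map_add, hx, hy]
  | add x y hx hy => rw [phiForm_add_left, phiForm_add_right, map_add, hx, hy]

end Phi

/-! ### The inner-product space `⨂^un H i` -/

section Un

variable (H : I → Type*) [∀ i, NormedAddCommGroup (H i)] [∀ i, InnerProductSpace ℂ (H i)]

/-- The family of the unit spheres of the spaces `H i`. -/
def unitSpheres : Π i, Set (H i) := fun i => Metric.sphere (0 : H i) 1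

/-- `⨂^un H i`: the span of the elementary tensors of families of unit vectors. -/
def unTensor : Submodule ℂ (⨂[ℂ] i, H i) :=
  Submodule.span ℂ (PiTensorProduct.tprod ℂ '' {x | ∀ i, x i ∈ unitSpheres H i})

variable {H}

open scoped ComplexOrder in
theorem posSemidef_phiForm {n : ℕ} (u : Fin n → Π i, H i) (hu : ∀ k i, ‖u k i‖ = 1) :
    (Matrix.of fun k l => phiForm (PiTensorProduct.tprod ℂ (u k))
      (PiTensorProduct.tprod ℂ (u l))).PosSemidef := by
  classical
  let s : Setoid (Fin n) := (Filter.productSetoid cofinite H).comap u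
  let r : Fin n → Fin n := fun k => (Quotient.mk s k).out
  have hr : ∀ k l, r k = r l ↔ ∀ᶠ i in cofinite, u k i = u l i := by
    intro k l
    constructor
    · intro h
      have h2 : Quotient.mk s k = Quotient.mk s l := by
        rw [← Quotient.out_eq (Quotient.mk s k), ← Quotient.out_eq (Quotient.mk s l)]
        exact congrArg _ h
      exact Quotient.exact h2
    · intro h
      have h2 : Quotient.mk s k = Quotient.mk s l := Quotient.sound h
      simp only [r, h2]
  have hfin : (⋃ p ∈ {p : Fin n × Fin n | r p.1 = r p.2},
      {i | ¬ (u p.1 i = u p.2 i)}).Finite := by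
    refine Set.Finite.biUnion (Set.toFinite _) ?_
    intro p hp
    exact Filter.eventually_cofinite.1 ((hr _ _).1 hp)
  let F := hfin.toFinset
  have hF : ∀ k l, r k = r l → ∀ i ∉ F, u k i = u l i := by
    intro k l hkl i hi
    by_contra hne
    exact hi (hfin.mem_toFinset.2 (Set.mem_biUnion (x := (k, l)) hkl hne))
  have hinner : ∀ k l i, inner ℂ (u k i) (u l i) = 1 ↔ u k i = u l i := fun k l i =>
    inner_eq_one_iff_of_norm_eq_one (hu k i) (hu l i)
  have hprod : ∀ G : Finset I,
      (Matrix.of fun k l => ∏ i ∈ G, inner ℂ (u k i) (u l i)).PosSemidef := by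
    intro G
    induction G using Finset.induction_on with
    | empty =>
      have h := Matrix.posSemidef_gram ℂ (fun _ : Fin n => (1 : ℂ))
      have e : (Matrix.of fun k l => ∏ i ∈ (∅ : Finset I), inner ℂ (u k i) (u l i)) =
          Matrix.gram ℂ (fun _ : Fin n => (1 : ℂ)) := by
        ext k l
        simp
      rw [e]
      exact h
    | insert a G ha ih =>
      have h := (Matrix.posSemidef_gram ℂ (fun k : Fin n => u k a)).hadamard ih
      have e : (Matrix.of fun k l => ∏ i ∈ insert a G, inner ℂ (u k i) (u l i)) =
          (Matrix.gram ℂ fun k : Fin n => u k a).hadamard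
            (Matrix.of fun k l => ∏ i ∈ G, inner ℂ (u k i) (u l i)) := by
        ext k l
        simp [Finset.prod_insert ha]
      rw [e]
      exact h
  have hind := Matrix.posSemidef_gram ℂ
    (fun k : Fin n => (EuclideanSpace.single (r k) (1 : ℂ) : EuclideanSpace ℂ (Fin n)))
  have e : (Matrix.of fun k l => phiForm (PiTensorProduct.tprod ℂ (u k))
      (PiTensorProduct.tprod ℂ (u l))) =
      (Matrix.gram ℂ fun k : Fin n =>
        (EuclideanSpace.single (r k) (1 : ℂ) : EuclideanSpace ℂ (Fin n))).hadamard
        (Matrix.of fun k l => ∏ i ∈ F, inner ℂ (u k i) (u l i)) := by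
    ext k l
    simp only [Matrix.of_apply, Matrix.hadamard_apply, Matrix.gram_apply, phiForm_tprod, hinner,
      ← hr, EuclideanSpace.inner_single_left, map_one, one_mul, PiLp.single_apply]
    by_cases h : r k = r l
    · rw [if_pos h, if_pos h, one_mul]
      refine finprod_eq_prod_of_mulSupport_subset _ ?_
      intro i hi
      by_contra hiF
      exact hi ((hinner k l i).2 (hF k l h i hiF))
    · rw [if_neg h, if_neg h, zero_mul]
  rw [e]
  exact hind.hadamard (hprod F)

theorem phiForm_self_nonneg {ξ : ⨂[ℂ] i, H i} (hξ : ξ ∈ unTensor H) :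
    0 ≤ RCLike.re (phiForm ξ ξ) := by
  open scoped ComplexOrder in
  obtain ⟨n, c, g, rfl⟩ := Submodule.mem_span_set'.1 hξ
  choose u hu1 hu2 using fun k => (g k).2
  have h := (posSemidef_phiForm u
    (fun k i => mem_sphere_zero_iff_norm.1 (hu1 k i))).dotProduct_mulVec_nonneg c
  have h2 : phiForm (∑ k, c k • (g k : ⨂[ℂ] i, H i)) (∑ k, c k • (g k : ⨂[ℂ] i, H i)) =
      star c ⬝ᵥ Matrix.mulVec (Matrix.of fun k l => phiForm (PiTensorProduct.tprod ℂ (u k))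
        (PiTensorProduct.tprod ℂ (u l))) c := by
    simp only [hu2, phiForm, dotProduct, Matrix.mulVec, map_sum, LinearMap.sum_apply,
      LinearMap.map_smulₛₗ, LinearMap.smul_apply, smul_eq_mul, Matrix.of_apply, Finset.mul_sum,
      Pi.star_apply, RCLike.star_def, RingHom.id_apply]
    rw [Finset.sum_comm]
    refine Finset.sum_congr rfl fun k _ => Finset.sum_congr rfl fun l _ => ?_
    ring
  rw [h2]
  exact (RCLike.nonneg_iff.1 h).1

/-- The inner product `⟨·, ·⟩_{φ₁}` on a subspace of `⨂^un H i`. -/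
@[reducible]
def phiCore (V : Submodule ℂ (⨂[ℂ] i, H i)) (hV : V ≤ unTensor H) :
    PreInnerProductSpace.Core ℂ V where
  inner ξ η := phiForm (ξ : ⨂[ℂ] i, H i) η
  conj_inner_symm _ _ := phiForm_conj_symm _ _
  re_inner_nonneg ξ := phiForm_self_nonneg (hV ξ.2)
  add_left _ _ _ := phiForm_add_left _ _ _
  smul_left _ _ _ := phiForm_smul_left _ _ _

instance instSeminormedUn : SeminormedAddCommGroup (unTensor H) :=
  @InnerProductSpace.Core.toSeminormedAddCommGroup ℂ _ _ _ _ (phiCore (unTensor H) le_rfl)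

instance instInnerUn : InnerProductSpace ℂ (unTensor H) :=
  InnerProductSpace.ofCore (phiCore (unTensor H) le_rfl)

theorem inner_unTensor (ξ η : unTensor H) :
    inner ℂ ξ η = phiOne I (tensorForm H (ξ : ⨂[ℂ] i, H i) (η : ⨂[ℂ] i, H i)) := rfl

variable (H) in
/-- The Hilbert space obtained by completing `⨂^un H i` (`Completion` is the separated completion,
so that nothing depends on whether definiteness of the form has been established). -/
abbrev PhiOneTensor := UniformSpace.Completion (unTensor H)

variable (H) in
/-- The classes of families of unit vectors. -/
abbrev UnClass := ClassSet (unitSpheres H)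

theorem classSpan_le_unTensor (μ : UnClass H) : classSpan (unitSpheres H) μ ≤ unTensor H := by
  classical
  refine Submodule.span_le.2 ?_
  rintro _ ⟨x, ⟨u, -, hx⟩, rfl⟩
  have hfin : {i | ¬ x i = u i}.Finite := Filter.eventually_cofinite.1 hx
  by_cases h0 : ∃ i, x i = 0
  · obtain ⟨i, hi⟩ := h0
    rw [MultilinearMap.map_coord_zero _ i hi]
    exact zero_mem _
  · push Not at h0
    let F := hfin.toFinset
    let y : Π i, H i := F.piecewise (fun i => ((‖x i‖ : ℂ)⁻¹) • x i) x
    have hy : ∀ i, y i ∈ unitSpheres H i := by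
      intro i
      refine mem_sphere_zero_iff_norm.2 ?_
      by_cases hi : i ∈ F
      · simp only [y, Finset.piecewise_eq_of_mem _ _ _ hi, norm_smul, norm_inv, Complex.norm_real,
          norm_norm]
        exact inv_mul_cancel₀ (norm_ne_zero_iff.2 (h0 i))
      · have hxi : x i = u i := by
          by_contra hne
          exact hi (hfin.mem_toFinset.2 hne)
        simp only [y, Finset.piecewise_eq_of_notMem _ _ _ hi, hxi]
        exact mem_sphere_zero_iff_norm.1 (u i).2
    have h1 : PiTensorProduct.tprod ℂ y =
        (∏ i ∈ F, ((‖x i‖ : ℂ)⁻¹)) • PiTensorProduct.tprod ℂ x :=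
      MultilinearMap.map_piecewise_smul _ _ _ _
    have h2 : (∏ i ∈ F, ((‖x i‖ : ℂ)⁻¹)) ≠ 0 :=
      Finset.prod_ne_zero_iff.2 fun i _ => inv_ne_zero (by simpa using h0 i)
    have h3 : PiTensorProduct.tprod ℂ x =
        (∏ i ∈ F, ((‖x i‖ : ℂ)⁻¹))⁻¹ • PiTensorProduct.tprod ℂ y := by
      rw [h1, smul_smul, inv_mul_cancel₀ h2, one_smul]
    rw [SetLike.mem_coe, h3]
    exact Submodule.smul_mem _ _ (Submodule.subset_span ⟨y, hy, rfl⟩)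

/-- `⨂^μ H i`, a subspace of `⨂^un H i`. -/
def muTensor (μ : UnClass H) : Submodule ℂ (⨂[ℂ] i, H i) := classSpan (unitSpheres H) μ

theorem muTensor_le_unTensor (μ : UnClass H) : muTensor μ ≤ unTensor H :=
  classSpan_le_unTensor μ

instance instSeminormedMu (μ : UnClass H) : SeminormedAddCommGroup (muTensor μ) :=
  @InnerProductSpace.Core.toSeminormedAddCommGroup ℂ _ _ _ _
    (phiCore (muTensor μ) (muTensor_le_unTensor μ))

instance instInnerMu (μ : UnClass H) : InnerProductSpace ℂ (muTensor μ) :=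
  InnerProductSpace.ofCore (phiCore (muTensor μ) (muTensor_le_unTensor μ))

theorem inner_muTensor (μ : UnClass H) (ξ η : muTensor μ) :
    inner ℂ ξ η = phiOne I (tensorForm H (ξ : ⨂[ℂ] i, H i) (η : ⨂[ℂ] i, H i)) := rfl

/-- The Hilbert space obtained by completing `⨂^μ H i`. -/
abbrev MuTensor (μ : UnClass H) := UniformSpace.Completion (muTensor μ)

end Un

/-! ### Representations -/

section Representations

variable {A : I → Type*} [∀ i, Ring (A i)] [∀ i, StarRing (A i)] [∀ i, Algebra ℂ (A i)]
  [∀ i, StarModule ℂ (A i)]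
  {H : I → Type*} [∀ i, NormedAddCommGroup (H i)] [∀ i, InnerProductSpace ℂ (H i)]
  [∀ i, CompleteSpace (H i)]

/-- The canonical map `⨂ A i → L(⨂ H i)`, with `(⨂ a i) (⨂ x i) = ⨂ (Ψ i (a i) (x i))`. -/
def tensorRep (Ψ : Π i, A i →⋆ₐ[ℂ] (H i →L[ℂ] H i)) :
    (⨂[ℂ] i, A i) →ₗ[ℂ] (⨂[ℂ] i, H i) →ₗ[ℂ] (⨂[ℂ] i, H i) :=
  PiTensorProduct.piTensorHomMap ∘ₗ PiTensorProduct.map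
    (fun i => ContinuousLinearMap.coeLM ℂ ∘ₗ (Ψ i).toAlgHom.toLinearMap)

theorem tensorRep_tprod (Ψ : Π i, A i →⋆ₐ[ℂ] (H i →L[ℂ] H i)) (a : Π i, A i) (x : Π i, H i) :
    tensorRep Ψ (PiTensorProduct.tprod ℂ a) (PiTensorProduct.tprod ℂ x) =
      PiTensorProduct.tprod ℂ (fun i => Ψ i (a i) (x i)) := by
  simp only [tensorRep, LinearMap.comp_apply, PiTensorProduct.map_tprod,
    PiTensorProduct.piTensorHomMap_tprod_tprod]
  rfl

/-- The representation `π` of `⨂^ut A i` on the completion of `⨂^un H i` is induced by the canonical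
map `⨂ A i → L(⨂ H i)`: the latter maps `⨂^un H i` to itself for elements of `⨂^ut A i`, and `π`
extends it. -/
def IsInducedUt (Ψ : Π i, A i →⋆ₐ[ℂ] (H i →L[ℂ] H i))
    (π : utAlg A →⋆ₐ[ℂ] (PhiOneTensor H →L[ℂ] PhiOneTensor H)) : Prop :=
  ∀ (a : utAlg A) (ξ : unTensor H), ∃ η : unTensor H,
    (η : ⨂[ℂ] i, H i) = tensorRep Ψ (a : ⨂[ℂ] i, A i) (ξ : ⨂[ℂ] i, H i) ∧
      π a (ξ : PhiOneTensor H) = (η : PhiOneTensor H)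

/-- The representation `ρ` of `⨂^e A i` on the completion of `⨂^μ H i` is induced by the canonical
map `⨂ A i → L(⨂ H i)`. -/
def IsInducedE (Ψ : Π i, A i →⋆ₐ[ℂ] (H i →L[ℂ] H i)) (μ : UnClass H)
    (ρ : eAlg A →⋆ₐ[ℂ] (MuTensor μ →L[ℂ] MuTensor μ)) : Prop :=
  ∀ (a : eAlg A) (ξ : muTensor μ), ∃ η : muTensor μ,
    (η : ⨂[ℂ] i, H i) = tensorRep Ψ (a : ⨂[ℂ] i, A i) (ξ : ⨂[ℂ] i, H i) ∧
      ρ a (ξ : MuTensor μ) = (η : MuTensor μ)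

open Classical in
/-- The pair (completion of `⨂^un H i`, restriction of `π` to `⨂^e A i`) is the Hilbert space direct
sum of the pairs (completion of `⨂^μ H i`, `ρ μ`), along the unitary that extends the inclusions
`⨂^μ H i ⊆ ⨂^un H i`. -/
def IsDirectSum (π : utAlg A →⋆ₐ[ℂ] (PhiOneTensor H →L[ℂ] PhiOneTensor H))
    (ρ : Π μ : UnClass H, eAlg A →⋆ₐ[ℂ] (MuTensor μ →L[ℂ] MuTensor μ)) : Prop :=
  ∃ U : lp (fun μ : UnClass H => MuTensor μ) 2 ≃ₗᵢ[ℂ] PhiOneTensor H,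
    (∀ (μ : UnClass H) (ξ : muTensor μ),
      U (lp.single 2 μ (ξ : MuTensor μ)) =
        ((Submodule.inclusion (muTensor_le_unTensor μ) ξ : unTensor H) : PhiOneTensor H)) ∧
    ∀ (a : eAlg A) (f : lp (fun μ : UnClass H => MuTensor μ) 2) (μ : UnClass H),
      U.symm ((π.comp (StarSubalgebra.inclusion (eAlg_le_utAlg A))) a (U f)) μ = ρ μ a (f μ)

end Representations

end InfTensor

end

noncomputable section

namespace InfTensor

variable {I : Type*}

/-! ### Extending `*`-representations by bounded operators to the completion -/

section Completion

open UniformSpace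

variable {S E : Type*} [Ring S] [StarRing S] [Algebra ℂ S]
  [SeminormedAddCommGroup E] [InnerProductSpace ℂ E]

/-! Boundedness is the analytic point of the existence statements. A tensor product of unitaries
preserves the form, which sees vectors only through the scalars `inner ℂ (x i) (y i)`. An element of
`utAlg A` is a combination of tensors that are unitary off a finite set. At the remaining
coordinates a bounded operator is a combination of unitaries (`CStarAlgebra.span_unitary`), so the
operator is a finite combination of isometries (`exists_bound_map`). With the coordinatewise adjoint
relation `phiForm_tensorRep_star`, it extends to the completion, uniquely by density.

Unit vectors have inner product 1 only if they are equal, so different classes span orthogonal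
subspaces (`phiForm_eq_zero_of_ne`). These subspaces together span `unTensor H`, which gives the
Hilbert sum.

For injectivity, let `∑ k, c k • tprod (b k)` act as zero. Unit vectors `z i` are chosen so that the
distinct ones among the `b k i` move `z i` to distinct vectors. Testing at `z` and its image under
`b l` off a finite set `F` kills every term outside the class of `b l`. On `F` what is left are
products of vector functionals, which separate points since each `Ψ i` is injective. Hence the part
of the sum in each class vanishes (`sum_smul_tprod_piecewise_eq_zero`). -/

/-- The extension to the completion of a representation by bounded operators. -/
def completionRep (φ : S →ₐ[ℂ] Module.End ℂ E)
    (hφ : ∀ a x y, inner ℂ (φ (star a) x) y = inner ℂ x (φ a y))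
    (hb : ∀ a, ∃ C, ∀ x, ‖φ a x‖ ≤ C * ‖x‖) :
    S →⋆ₐ[ℂ] (Completion E →L[ℂ] Completion E) :=
  let T : S → E →L[ℂ] E := fun a => (φ a).mkContinuousOfExistsBound (hb a)
  have hT : ∀ a x, T a x = φ a x := fun _ _ => rfl
  have hc : ∀ a (x : E), (T a).completion x = (φ a x : Completion E) := fun a x => by
    rw [ContinuousLinearMap.completion_apply_coe, hT]
  have hext : ∀ f g : Completion E →L[ℂ] Completion E, (∀ x : E, f x = g x) → f = g :=
    fun f g h => ContinuousLinearMap.ext fun x =>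
      Completion.induction_on x (isClosed_eq f.continuous g.continuous) h
  { toFun := fun a => (T a).completion
    map_one' := hext _ _ fun x => by simp [hc]
    map_mul' := fun a b => hext _ _ fun x => by simp [hc]
    map_zero' := hext _ _ fun x => by simp [hc, Completion.coe_zero]
    map_add' := fun a b => hext _ _ fun x => by simp [hc, Completion.coe_add]
    commutes' := fun r => hext _ _ fun x => by
      simp [hc, Algebra.algebraMap_eq_smul_one, Completion.coe_smul]
    map_star' := fun a => by
      rw [ContinuousLinearMap.star_eq_adjoint, ContinuousLinearMap.eq_adjoint_iff]
      intro x y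
      induction x, y using Completion.induction_on₂ with
      | hp => exact isClosed_eq (by fun_prop) (by fun_prop)
      | ih x y => simp only [hc, Completion.inner_coe, hφ] }

theorem completionRep_coe (φ : S →ₐ[ℂ] Module.End ℂ E) (hφ) (hb) (a : S) (x : E) :
    completionRep φ hφ hb a (x : Completion E) = (φ a x : Completion E) :=
  ContinuousLinearMap.completion_apply_coe _ _

/-- Uniqueness is density of the image of `E`. Since `E` is only seminormed and its completion is
separated, definiteness of the form is never needed. -/
theorem existsUnique_completionRep (φ : S →ₐ[ℂ] Module.End ℂ E)
    (hφ : ∀ a x y, inner ℂ (φ (star a) x) y = inner ℂ x (φ a y))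
    (hb : ∀ a, ∃ C, ∀ x, ‖φ a x‖ ≤ C * ‖x‖) :
    ∃! π : S →⋆ₐ[ℂ] (Completion E →L[ℂ] Completion E),
      ∀ a (x : E), π a (x : Completion E) = (φ a x : Completion E) := by
  refine ⟨completionRep φ hφ hb, completionRep_coe φ hφ hb, fun π hπ => ?_⟩
  refine StarAlgHom.ext fun a => ContinuousLinearMap.ext fun x => ?_
  induction x using Completion.induction_on with
  | hp => exact isClosed_eq (π a).continuous (completionRep φ hφ hb a).continuous
  | ih x => rw [hπ, completionRep_coe]

end Completion

/-! ### The canonical map as a representation on the algebraic tensor product -/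

section Canonical

variable {A : I → Type*} [∀ i, Ring (A i)] [∀ i, StarRing (A i)] [∀ i, Algebra ℂ (A i)]
  [∀ i, StarModule ℂ (A i)]
  {H : I → Type*} [∀ i, NormedAddCommGroup (H i)] [∀ i, InnerProductSpace ℂ (H i)]
  [∀ i, CompleteSpace (H i)] (Ψ : Π i, A i →⋆ₐ[ℂ] (H i →L[ℂ] H i))

theorem tensorRep_one : tensorRep Ψ 1 = LinearMap.id := by
  ext x
  rw [PiTensorProduct.one_def]
  simp only [LinearMap.compMultilinearMap_apply, tensorRep_tprod, LinearMap.id_apply]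
  simp

theorem tensorRep_mul (a b : ⨂[ℂ] i, A i) :
    tensorRep Ψ (a * b) = tensorRep Ψ a ∘ₗ tensorRep Ψ b := by
  induction a using PiTensorProduct.induction_on with
  | smul_tprod r a =>
    induction b using PiTensorProduct.induction_on with
    | smul_tprod s b =>
      ext x
      simp [PiTensorProduct.tprod_mul_tprod, tensorRep_tprod, smul_smul, mul_comm]
    | add x y hx hy => rw [mul_add, map_add, map_add, hx, hy, LinearMap.comp_add]
  | add x y hx hy => rw [add_mul, map_add, map_add, hx, hy, LinearMap.add_comp]

/-- On elementary tensors the two sides agree coordinate by coordinate, before `phiOne` is applied;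
neither unit vectors nor unitaries are needed. -/
theorem phiForm_tensorRep_star (a : ⨂[ℂ] i, A i) (ξ η : ⨂[ℂ] i, H i) :
    phiForm (tensorRep Ψ (star a) ξ) η = phiForm ξ (tensorRep Ψ a η) := by
  induction a using PiTensorProduct.induction_on with
  | smul_tprod r a =>
    induction ξ using PiTensorProduct.induction_on with
    | smul_tprod s x =>
      induction η using PiTensorProduct.induction_on with
      | smul_tprod t y =>
        have h : phiForm (PiTensorProduct.tprod ℂ fun i => Ψ i (star (a i)) (x i))
            (PiTensorProduct.tprod ℂ y) = phiForm (PiTensorProduct.tprod ℂ x)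
              (PiTensorProduct.tprod ℂ fun i => Ψ i (a i) (y i)) := by
          simp only [phiForm, tensorForm_tprod, map_star, ContinuousLinearMap.star_eq_adjoint,
            ContinuousLinearMap.adjoint_inner_left]
        simp only [star_smul, star_tprod, map_smul, LinearMap.smul_apply, tensorRep_tprod,
          phiForm_smul_left, phiForm_smul_right, Pi.star_apply, h, RCLike.star_def,
          RCLike.conj_conj]
        ring
      | add x y hx hy => rw [map_add, phiForm_add_right, phiForm_add_right, hx, hy]
    | add x y hx hy => rw [map_add, phiForm_add_left, phiForm_add_left, hx, hy]
  | add x y hx hy =>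
    rw [star_add, map_add, map_add, LinearMap.add_apply, LinearMap.add_apply, phiForm_add_left,
      phiForm_add_right, hx, hy]

/-- The representation of a subalgebra of `⨂ A i` on an invariant subspace of `⨂ H i`. -/
def restrictRep (S : StarSubalgebra ℂ (⨂[ℂ] i, A i)) (V : Submodule ℂ (⨂[ℂ] i, H i))
    (h : ∀ a ∈ S, ∀ ξ ∈ V, tensorRep Ψ a ξ ∈ V) : S →ₐ[ℂ] Module.End ℂ V :=
  AlgHom.ofLinearMap
    { toFun := fun a => (tensorRep Ψ (a : ⨂[ℂ] i, A i)).restrict (h a a.2)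
      map_add' := fun a b => by ext ξ; simp [LinearMap.restrict_apply]
      map_smul' := fun c a => by ext ξ; simp [LinearMap.restrict_apply] }
    (by ext ξ; simp [LinearMap.restrict_apply, tensorRep_one])
    (fun a b => by ext ξ; simp [LinearMap.restrict_apply, tensorRep_mul])

theorem tprod_mem_unTensor {x : Π i, H i} [∀ i, Nontrivial (H i)]
    (hx : ∀ᶠ i in cofinite, ‖x i‖ = 1) : PiTensorProduct.tprod ℂ x ∈ unTensor H := by
  classical
  -- The finitely many coordinates of norm other than 1 get an arbitrary unit vector, so that `x`
  -- belongs to the class of `u`.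
  have hu : ∀ i, ∃ u : unitSpheres H i, ‖x i‖ = 1 → (u : H i) = x i := fun i => by
    by_cases hi : ‖x i‖ = 1
    · exact ⟨⟨x i, mem_sphere_zero_iff_norm.2 hi⟩, fun _ => rfl⟩
    · obtain ⟨u, hu⟩ := exists_norm_eq (H i) (c := 1) zero_le_one
      exact ⟨⟨u, mem_sphere_zero_iff_norm.2 hu⟩, fun h => absurd h hi⟩
  choose u hu using hu
  refine classSpan_le_unTensor (u : UnClass H) (Submodule.subset_span ⟨x, ⟨u, rfl, ?_⟩, rfl⟩)
  exact hx.mono fun i hi => (hu i hi).symm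

theorem tensorRep_mem_of_mem_span {T : Set (Π i, A i)} {X : Set (Π i, H i)}
    {V : Submodule ℂ (⨂[ℂ] i, H i)}
    (h : ∀ a ∈ T, ∀ x ∈ X, PiTensorProduct.tprod ℂ (fun i => Ψ i (a i) (x i)) ∈ V)
    {a : ⨂[ℂ] i, A i} (ha : a ∈ Submodule.span ℂ (PiTensorProduct.tprod ℂ '' T))
    {ξ : ⨂[ℂ] i, H i} (hξ : ξ ∈ Submodule.span ℂ (PiTensorProduct.tprod ℂ '' X)) :
    tensorRep Ψ a ξ ∈ V := by
  have := Submodule.apply_mem_map₂ (tensorRep Ψ) ha hξ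
  rw [Submodule.map₂_span_span] at this
  refine Submodule.span_le.2 ?_ this
  rintro _ ⟨_, ⟨a, ha, rfl⟩, _, ⟨x, hx, rfl⟩, rfl⟩
  simpa only [SetLike.mem_coe, tensorRep_tprod] using h a ha x hx

end Canonical

/-! ### Boundedness of the operators of the canonical map -/

section Bounded

variable {H : I → Type*} [∀ i, NormedAddCommGroup (H i)] [∀ i, InnerProductSpace ℂ (H i)]
  [∀ i, CompleteSpace (H i)]

/-- The form depends only on the coordinatewise inner products, and each unitary preserves its own.
-/
theorem phiForm_map_of_mem_unitary {b : Π i, H i →L[ℂ] H i}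
    (hb : ∀ i, b i ∈ unitary (H i →L[ℂ] H i))
    (ξ η : ⨂[ℂ] i, H i) :
    phiForm (PiTensorProduct.map (fun i => (b i : H i →ₗ[ℂ] H i)) ξ)
      (PiTensorProduct.map (fun i => (b i : H i →ₗ[ℂ] H i)) η) = phiForm ξ η := by
  induction ξ using PiTensorProduct.induction_on with
  | smul_tprod s x =>
    induction η using PiTensorProduct.induction_on with
    | smul_tprod t y =>
      simp only [map_smul, PiTensorProduct.map_tprod, phiForm_smul_left, phiForm_smul_right,
        ContinuousLinearMap.coe_coe]
      congr 2
      simp only [phiForm, tensorForm_tprod, ContinuousLinearMap.inner_map_map_of_mem_unitary (hb _)]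
    | add x y hx hy => rw [map_add, phiForm_add_right, phiForm_add_right, hx, hy]
  | add x y hx hy => rw [map_add, phiForm_add_left, phiForm_add_left, hx, hy]

theorem norm_unTensor_eq (ξ : unTensor H) :
    ‖ξ‖ = √(RCLike.re (phiForm (ξ : ⨂[ℂ] i, H i) ξ)) := rfl

theorem map_mem_unTensor {b : Π i, H i →L[ℂ] H i}
    (hb : ∀ᶠ i in cofinite, b i ∈ unitary (H i →L[ℂ] H i)) {ξ : ⨂[ℂ] i, H i}
    (hξ : ξ ∈ unTensor H) : PiTensorProduct.map (fun i => (b i : H i →ₗ[ℂ] H i)) ξ ∈ unTensor H := by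
  refine (Submodule.span_le (p := (unTensor H).comap _)).2 ?_ hξ
  rintro _ ⟨x, hx, rfl⟩
  have hx' : ∀ i, ‖x i‖ = 1 := fun i => mem_sphere_zero_iff_norm.1 (hx i)
  -- Nontriviality comes from the generator itself: its coordinates are unit vectors.
  have : ∀ i, Nontrivial (H i) := fun i =>
    nontrivial_of_ne (x i) 0 (norm_ne_zero_iff.1 (by simp [hx' i]))
  rw [Submodule.comap_coe, Set.mem_preimage, PiTensorProduct.map_tprod]
  refine tprod_mem_unTensor (hb.mono fun i hi => ?_)
  rw [ContinuousLinearMap.coe_coe, ContinuousLinearMap.norm_map_of_mem_unitary hi, hx' i]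

/-- Induction on the set of possibly non-unitary coordinates, each step trading one coordinate for a
combination of unitaries. Quantifying over `η` keeps membership proofs out of the norms. -/
theorem exists_bound_map (F : Finset I) (b : Π i, H i →L[ℂ] H i)
    (hb : ∀ i ∉ F, b i ∈ unitary (H i →L[ℂ] H i)) :
    ∃ C : ℝ, ∀ ξ η : unTensor H,
      (η : ⨂[ℂ] i, H i) = PiTensorProduct.map (fun i => (b i : H i →ₗ[ℂ] H i)) (ξ : ⨂[ℂ] i, H i) →
      ‖η‖ ≤ C * ‖ξ‖ := by
  classical
  induction F using Finset.induction_on generalizing b with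
  | empty =>
    refine ⟨1, fun ξ η h => ?_⟩
    rw [one_mul, norm_unTensor_eq, norm_unTensor_eq, h,
      phiForm_map_of_mem_unitary fun i => hb i (Finset.notMem_empty i)]
  | insert i F hi ih =>
    have hupd : ∀ z : H i →L[ℂ] H i,
        (fun j => (Function.update b i z j : H j →ₗ[ℂ] H j)) =
          Function.update (fun j => (b j : H j →ₗ[ℂ] H j)) i (z : H i →ₗ[ℂ] H i) := fun z => by
      ext j : 1
      exact Function.apply_update (fun j (w : H j →L[ℂ] H j) => (w : H j →ₗ[ℂ] H j)) b i z j
    have hmem : ∀ (z : H i →L[ℂ] H i) (ξ : unTensor H),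
        PiTensorProduct.map (Function.update (fun j => (b j : H j →ₗ[ℂ] H j)) i
          (z : H i →ₗ[ℂ] H i)) (ξ : ⨂[ℂ] i, H i) ∈ unTensor H := fun z ξ => by
      rw [← hupd]
      refine map_mem_unTensor ?_ ξ.2
      filter_upwards [(insert i F).eventually_cofinite_notMem] with j hj
      rw [Function.update_of_ne (by rintro rfl; exact hj (Finset.mem_insert_self _ F))]
      exact hb j hj
    -- With the other coordinates fixed, the `z` admitting a bound form a subspace. It contains the
    -- unitaries by `ih`, and these span all bounded operators. `hmem` gives the summands a norm of
    -- their own.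
    have key : ∀ z : H i →L[ℂ] H i, ∃ C : ℝ, ∀ ξ η : unTensor H,
        (η : ⨂[ℂ] i, H i) = PiTensorProduct.map (Function.update
          (fun j => (b j : H j →ₗ[ℂ] H j)) i (z : H i →ₗ[ℂ] H i)) (ξ : ⨂[ℂ] i, H i) →
        ‖η‖ ≤ C * ‖ξ‖ := by
      intro z
      have hz : z ∈ Submodule.span ℂ (unitary (H i →L[ℂ] H i) : Set (H i →L[ℂ] H i)) := by
        rw [CStarAlgebra.span_unitary]
        trivial
      induction hz using Submodule.span_induction with
      | mem z hz =>
        obtain ⟨C, hC⟩ := ih (Function.update b i z) fun j hj => by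
          rcases eq_or_ne j i with rfl | hji
          · simpa using hz
          · rw [Function.update_of_ne hji]
            exact hb j (by simp [hji, hj])
        exact ⟨C, by simpa only [hupd] using hC⟩
      | zero =>
        refine ⟨0, fun ξ η h => ?_⟩
        rw [ContinuousLinearMap.toLinearMap_zero, ← PiTensorProduct.mapMultilinear_apply,
          MultilinearMap.map_update_zero, LinearMap.zero_apply, ZeroMemClass.coe_eq_zero] at h
        simp [h]
      | add z w _ _ hz hw =>
        obtain ⟨C, hC⟩ := hz
        obtain ⟨D, hD⟩ := hw
        refine ⟨C + D, fun ξ η h => ?_⟩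
        have e : η = ⟨_, hmem z ξ⟩ + ⟨_, hmem w ξ⟩ := by
          ext
          rw [h, ContinuousLinearMap.toLinearMap_add, PiTensorProduct.map_update_add]
          rfl
        rw [e, add_mul]
        exact (norm_add_le _ _).trans (add_le_add (hC ξ _ rfl) (hD ξ _ rfl))
      | smul c z _ hz =>
        obtain ⟨C, hC⟩ := hz
        refine ⟨‖c‖ * C, fun ξ η h => ?_⟩
        have e : η = c • ⟨_, hmem z ξ⟩ := by
          ext
          rw [h, ContinuousLinearMap.toLinearMap_smul, PiTensorProduct.map_update_smul]
          rfl
        rw [e, norm_smul, mul_assoc]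
        exact mul_le_mul_of_nonneg_left (hC ξ _ rfl) (norm_nonneg c)
    obtain ⟨C, hC⟩ := key (b i)
    exact ⟨C, by simpa only [← hupd, Function.update_eq_self] using hC⟩

end Bounded

/-! ### Invariance of the subspaces and existence of the induced representations -/

section Induced

variable {A : I → Type*} [∀ i, Ring (A i)] [∀ i, StarRing (A i)] [∀ i, Algebra ℂ (A i)]
  [∀ i, StarModule ℂ (A i)]
  {H : I → Type*} [∀ i, NormedAddCommGroup (H i)] [∀ i, InnerProductSpace ℂ (H i)]
  [∀ i, CompleteSpace (H i)] (Ψ : Π i, A i →⋆ₐ[ℂ] (H i →L[ℂ] H i))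

theorem mem_utAlg_iff (a : ⨂[ℂ] i, A i) : a ∈ utAlg A ↔
    a ∈ Submodule.span ℂ (PiTensorProduct.tprod ℂ ''
      {a : Π i, A i | ∀ᶠ i in cofinite, a i ∈ unitary (A i)}) := by
  have : a ∈ utAlg A ↔ a ∈ ⨆ ω, classSpan (unitarySets A) ω := Iff.rfl
  rw [this, iSup_classSpan]
  have : {x : Π i, A i | ∃ u : Π i, unitarySets A i, ∀ᶠ i in cofinite, x i = u i} =
      {a : Π i, A i | ∀ᶠ i in cofinite, a i ∈ unitary (A i)} := by
    classical
    ext x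
    constructor
    · rintro ⟨u, hu⟩
      exact hu.mono fun i hi => hi ▸ (u i).2
    · intro (hx : ∀ᶠ i in cofinite, x i ∈ unitary (A i))
      -- The default 1 is used only on the finite set where `x i` is not unitary.
      refine ⟨fun i => if h : x i ∈ unitary (A i) then ⟨x i, h⟩ else ⟨1, one_mem _⟩, ?_⟩
      exact hx.mono fun i hi => by simp [hi]
  rw [this]

theorem mem_eAlg_iff (a : ⨂[ℂ] i, A i) : a ∈ eAlg A ↔
    a ∈ Submodule.span ℂ (PiTensorProduct.tprod ℂ ''
      {a : Π i, A i | ∀ᶠ i in cofinite, a i = 1}) := by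
  have : a ∈ eAlg A ↔ a ∈ classSpan (unitarySets A) (oneClass A) := Iff.rfl
  rw [this, classSpan]
  congr! 3
  ext x
  exact mem_classPi_oneClass x

theorem tensorRep_tprod_eq_map (a : Π i, A i) : tensorRep Ψ (PiTensorProduct.tprod ℂ a) =
    PiTensorProduct.map (fun i => (Ψ i (a i) : H i →ₗ[ℂ] H i)) := by
  ext x
  simp only [LinearMap.compMultilinearMap_apply, tensorRep_tprod, PiTensorProduct.map_tprod]
  rfl

theorem eventually_map_mem_unitary {a : Π i, A i} (ha : ∀ᶠ i in cofinite, a i ∈ unitary (A i)) :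
    ∀ᶠ i in cofinite, Ψ i (a i) ∈ unitary (H i →L[ℂ] H i) :=
  ha.mono fun i hi => Unitary.map_mem (Ψ i) hi

theorem tensorRep_mem_unTensor {a : ⨂[ℂ] i, A i} (ha : a ∈ utAlg A) {ξ : ⨂[ℂ] i, H i}
    (hξ : ξ ∈ unTensor H) : tensorRep Ψ a ξ ∈ unTensor H := by
  rw [mem_utAlg_iff] at ha
  induction ha using Submodule.span_induction with
  | mem a ha =>
    obtain ⟨a, ha, rfl⟩ := ha
    rw [tensorRep_tprod_eq_map]
    exact map_mem_unTensor (eventually_map_mem_unitary Ψ ha) hξ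
  | zero => simp
  | add a b _ _ ha hb =>
    rw [map_add]
    exact add_mem ha hb
  | smul c a _ ha =>
    rw [map_smul]
    exact Submodule.smul_mem _ c ha

/-- Off a finite set `a` acts as the identity, so the class of a family is unchanged; a general
element of `utAlg A` may move it. -/
theorem tensorRep_mem_muTensor (μ : UnClass H) {a : ⨂[ℂ] i, A i} (ha : a ∈ eAlg A)
    {ξ : ⨂[ℂ] i, H i} (hξ : ξ ∈ muTensor μ) : tensorRep Ψ a ξ ∈ muTensor μ := by
  rw [mem_eAlg_iff] at ha
  refine tensorRep_mem_of_mem_span Ψ ?_ ha hξ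
  rintro a ha x ⟨u, hu, hx⟩
  refine Submodule.subset_span ⟨_, ⟨u, hu, ?_⟩, rfl⟩
  filter_upwards [ha, hx] with i h1 h2
  simp [h1, h2]

theorem exists_bound_tensorRep {a : ⨂[ℂ] i, A i} (ha : a ∈ utAlg A) :
    ∃ C : ℝ, ∀ ξ η : unTensor H, (η : ⨂[ℂ] i, H i) = tensorRep Ψ a ξ → ‖η‖ ≤ C * ‖ξ‖ := by
  have ha' := (mem_utAlg_iff a).1 ha
  clear ha
  induction ha' using Submodule.span_induction with
  | mem a ha =>
    obtain ⟨a, ha, rfl⟩ := ha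
    have hfin := Filter.eventually_cofinite.1 (eventually_map_mem_unitary Ψ ha)
    rw [tensorRep_tprod_eq_map]
    exact exists_bound_map hfin.toFinset _ fun i hi => by simpa using hi
  | zero =>
    refine ⟨0, fun ξ η h => ?_⟩
    rw [map_zero, LinearMap.zero_apply, ZeroMemClass.coe_eq_zero] at h
    simp [h]
  | add a b ha hb iha ihb =>
    obtain ⟨C, hC⟩ := iha
    obtain ⟨D, hD⟩ := ihb
    refine ⟨C + D, fun ξ η h => ?_⟩
    have e : η = ⟨_, tensorRep_mem_unTensor Ψ ((mem_utAlg_iff a).2 ha) ξ.2⟩ +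
        ⟨_, tensorRep_mem_unTensor Ψ ((mem_utAlg_iff b).2 hb) ξ.2⟩ := by
      ext
      rw [h, map_add]
      rfl
    rw [e, add_mul]
    exact (norm_add_le _ _).trans (add_le_add (hC ξ _ rfl) (hD ξ _ rfl))
  | smul c a ha iha =>
    obtain ⟨C, hC⟩ := iha
    refine ⟨‖c‖ * C, fun ξ η h => ?_⟩
    have e : η = c • ⟨_, tensorRep_mem_unTensor Ψ ((mem_utAlg_iff a).2 ha) ξ.2⟩ := by
      ext
      rw [h, map_smul]
      rfl
    rw [e, norm_smul, mul_assoc]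
    exact mul_le_mul_of_nonneg_left (hC ξ _ rfl) (norm_nonneg c)

theorem existsUnique_isInducedUt :
    ∃! π : utAlg A →⋆ₐ[ℂ] (PhiOneTensor H →L[ℂ] PhiOneTensor H), IsInducedUt Ψ π := by
  have h : ∀ a ∈ utAlg A, ∀ ξ ∈ unTensor H, tensorRep Ψ a ξ ∈ unTensor H :=
    fun a ha ξ hξ => tensorRep_mem_unTensor Ψ ha hξ
  have hex := existsUnique_completionRep (restrictRep Ψ (utAlg A) (unTensor H) h)
    (fun a ξ η => phiForm_tensorRep_star Ψ a ξ η)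
    (fun a => (exists_bound_tensorRep Ψ a.2).imp fun C hC ξ => hC ξ _ rfl)
  refine (existsUnique_congr fun π => ?_).1 hex
  -- The vector `η` in the definition of an induced representation is forced by its first equation,
  -- so the definition says just that the operator extends the restricted one.
  refine forall_congr' fun a => forall_congr' fun ξ => ⟨fun h => ⟨_, rfl, h⟩, ?_⟩
  rintro ⟨η, hη, hπ⟩
  rw [hπ]
  congr 1
  exact Subtype.ext hη

theorem existsUnique_isInducedE (μ : UnClass H) :
    ∃! ρ : eAlg A →⋆ₐ[ℂ] (MuTensor μ →L[ℂ] MuTensor μ), IsInducedE Ψ μ ρ := by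
  have h : ∀ a ∈ eAlg A, ∀ ξ ∈ muTensor μ, tensorRep Ψ a ξ ∈ muTensor μ :=
    fun a ha ξ hξ => tensorRep_mem_muTensor Ψ μ ha hξ
  have hex := existsUnique_completionRep (restrictRep Ψ (eAlg A) (muTensor μ) h)
    (fun a ξ η => phiForm_tensorRep_star Ψ a ξ η)
    -- The norm of `muTensor μ` is definitionally that of `unTensor H`, so the bound there is
    -- inherited.
    (fun a => (exists_bound_tensorRep Ψ (eAlg_le_utAlg A a.2)).imp fun C hC ξ =>
      hC (Submodule.inclusion (muTensor_le_unTensor μ) ξ)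
        (Submodule.inclusion (muTensor_le_unTensor μ) (restrictRep Ψ (eAlg A) (muTensor μ) h a ξ))
        rfl)
  refine (existsUnique_congr fun π => ?_).1 hex
  refine forall_congr' fun a => forall_congr' fun ξ => ⟨fun h => ⟨_, rfl, h⟩, ?_⟩
  rintro ⟨η, hη, hπ⟩
  rw [hπ]
  congr 1
  exact Subtype.ext hη

end Induced

/-! ### The direct sum decomposition -/

section DirectSum

open UniformSpace

variable {H : I → Type*} [∀ i, NormedAddCommGroup (H i)] [∀ i, InnerProductSpace ℂ (H i)]

/-- The inclusion of `⨂^μ H i` in `⨂^un H i`. -/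
def muInclusion (μ : UnClass H) : muTensor μ →L[ℂ] unTensor H :=
  (Submodule.inclusion (muTensor_le_unTensor μ)).mkContinuous 1 fun ξ => (one_mul ‖ξ‖).ge

/-- The isometric embedding of the completion of `⨂^μ H i` in the completion of `⨂^un H i`. -/
def muIsometry (μ : UnClass H) : MuTensor μ →ₗᵢ[ℂ] PhiOneTensor H where
  toLinearMap := (muInclusion μ).completion
  norm_map' ξ := by
    induction ξ using Completion.induction_on with
    | hp =>
      exact isClosed_eq (continuous_norm.comp (muInclusion μ).completion.continuous) continuous_norm
    | ih ξ =>
      rw [ContinuousLinearMap.coe_coe, ContinuousLinearMap.completion_apply_coe,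
        Completion.norm_coe, Completion.norm_coe]
      rfl

theorem muIsometry_coe (μ : UnClass H) (ξ : muTensor μ) :
    muIsometry μ (ξ : MuTensor μ) =
      ((Submodule.inclusion (muTensor_le_unTensor μ) ξ : unTensor H) : PhiOneTensor H) :=
  ContinuousLinearMap.completion_apply_coe (muInclusion μ) ξ

/-- A nonzero value would make almost all inner products of the unit representatives equal to 1. The
equality case of Cauchy–Schwarz then makes the representatives agree almost everywhere. -/
theorem phiForm_eq_zero_of_ne {μ ν : UnClass H} (h : μ ≠ ν) {ξ η : ⨂[ℂ] i, H i}
    (hξ : ξ ∈ muTensor μ) (hη : η ∈ muTensor ν) : phiForm ξ η = 0 := by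
  induction hξ, hη using Submodule.span_induction₂ with
  | mem_mem ξ η hξ hη =>
    obtain ⟨x, ⟨u, hu, hx⟩, rfl⟩ := hξ
    obtain ⟨y, ⟨v, hv, hy⟩, rfl⟩ := hη
    rw [phiForm_tprod, if_neg]
    intro h1
    refine h ?_
    rw [← hu, ← hv]
    refine Quotient.sound ?_
    change ∀ᶠ i in cofinite, u i = v i
    filter_upwards [h1, hx, hy] with i h1 hx hy
    rw [hx, hy, inner_eq_one_iff_of_norm_eq_one (mem_sphere_zero_iff_norm.1 (u i).2)
      (mem_sphere_zero_iff_norm.1 (v i).2)] at h1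
    exact Subtype.ext h1
  | zero_left η _ => simp [phiForm]
  | zero_right ξ _ => simp [phiForm]
  | add_left ξ ξ' η _ _ _ h1 h2 => rw [phiForm_add_left, h1, h2, add_zero]
  | add_right ξ η η' _ _ _ h1 h2 => rw [phiForm_add_right, h1, h2, add_zero]
  | smul_left c ξ η _ _ h1 => rw [phiForm_smul_left, h1, mul_zero]
  | smul_right c ξ η _ _ h1 => rw [phiForm_smul_right, h1, mul_zero]

theorem orthogonalFamily_muIsometry :
    OrthogonalFamily ℂ (fun μ : UnClass H => MuTensor μ) muIsometry := by
  intro μ ν h ξ η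
  induction ξ, η using Completion.induction_on₂ with
  | hp =>
    exact isClosed_eq (((muIsometry μ).continuous.comp continuous_fst).inner
      ((muIsometry ν).continuous.comp continuous_snd)) continuous_const
  | ih ξ η =>
    rw [muIsometry_coe, muIsometry_coe, Completion.inner_coe]
    exact phiForm_eq_zero_of_ne h ξ.2 η.2

theorem iSup_muTensor : ⨆ μ : UnClass H, muTensor μ = unTensor H := by
  refine le_antisymm (iSup_le muTensor_le_unTensor) (Submodule.span_le.2 ?_)
  rintro _ ⟨x, hx, rfl⟩
  let u : Π i, unitSpheres H i := fun i => ⟨x i, hx i⟩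
  exact le_iSup (fun μ : UnClass H => muTensor μ) (u : UnClass H)
    (Submodule.subset_span ⟨x, ⟨u, rfl, Eventually.of_forall fun _ => rfl⟩, rfl⟩)

theorem isHilbertSum_muIsometry :
    IsHilbertSum ℂ (fun μ : UnClass H => MuTensor μ) muIsometry := by
  refine IsHilbertSum.mk orthogonalFamily_muIsometry fun ξ hξ => ?_
  clear hξ
  induction ξ using Completion.induction_on with
  | hp =>
    exact (⨆ μ : UnClass H,
      LinearMap.range (muIsometry μ).toLinearMap).isClosed_topologicalClosure
  | ih ξ =>
    refine Submodule.le_topologicalClosure _ ?_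
    obtain ⟨ξ, hξ⟩ := ξ
    -- The comparison is made inside `⨂ H i`, where `iSup_muTensor` applies: the sum of ranges is
    -- pulled back along the dense embedding and pushed forward along the inclusion.
    have h : ⨆ μ : UnClass H, muTensor μ ≤ ((⨆ μ : UnClass H,
        LinearMap.range (muIsometry μ).toLinearMap).comap
          (Completion.toComplₗᵢ (𝕜 := ℂ) (E := unTensor H)).toLinearMap).map
            (unTensor H).subtype := by
      refine iSup_le fun μ η hη => ?_
      refine ⟨⟨η, muTensor_le_unTensor μ hη⟩, ?_, rfl⟩
      refine Submodule.mem_iSup_of_mem μ ⟨((⟨η, hη⟩ : muTensor μ) : MuTensor μ), ?_⟩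
      exact muIsometry_coe μ ⟨η, hη⟩
    obtain ⟨η, hη, h2⟩ := h (iSup_muTensor (H := H) ▸ hξ)
    have : η = ⟨ξ, hξ⟩ := Subtype.ext h2
    exact this ▸ hη

variable {A : I → Type*} [∀ i, Ring (A i)] [∀ i, StarRing (A i)] [∀ i, Algebra ℂ (A i)]
  [∀ i, StarModule ℂ (A i)] [∀ i, CompleteSpace (H i)]
  {Ψ : Π i, A i →⋆ₐ[ℂ] (H i →L[ℂ] H i)}
  {π : utAlg A →⋆ₐ[ℂ] (PhiOneTensor H →L[ℂ] PhiOneTensor H)}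

theorem IsInducedUt.apply_muIsometry (hπ : IsInducedUt Ψ π) {μ : UnClass H}
    {ρ : eAlg A →⋆ₐ[ℂ] (MuTensor μ →L[ℂ] MuTensor μ)} (hρ : IsInducedE Ψ μ ρ)
    (a : eAlg A) (ξ : MuTensor μ) :
    π (StarSubalgebra.inclusion (eAlg_le_utAlg A) a) (muIsometry μ ξ) = muIsometry μ (ρ a ξ) := by
  induction ξ using Completion.induction_on with
  | hp =>
    exact isClosed_eq ((π _).continuous.comp (muIsometry μ).continuous)
      ((muIsometry μ).continuous.comp (ρ a).continuous)
  | ih ξ =>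
    obtain ⟨η, hη, h1⟩ := hρ a ξ
    obtain ⟨ζ, hζ, h2⟩ := hπ (StarSubalgebra.inclusion (eAlg_le_utAlg A) a)
      (Submodule.inclusion (muTensor_le_unTensor μ) ξ)
    rw [h1, muIsometry_coe, muIsometry_coe, h2]
    congr 1
    exact Subtype.ext (hζ.trans hη.symm)

theorem IsInducedUt.isDirectSum (hπ : IsInducedUt Ψ π)
    {ρ : Π μ : UnClass H, eAlg A →⋆ₐ[ℂ] (MuTensor μ →L[ℂ] MuTensor μ)}
    (hρ : ∀ μ, IsInducedE Ψ μ (ρ μ)) : IsDirectSum π ρ := by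
  classical
  let U := (isHilbertSum_muIsometry (H := H)).linearIsometryEquiv.symm
  have hU : ∀ (μ : UnClass H) (ξ : MuTensor μ), U (lp.single 2 μ ξ) = muIsometry μ ξ :=
    fun μ ξ => isHilbertSum_muIsometry.linearIsometryEquiv_symm_apply_single ξ
  refine ⟨U, fun μ ξ => ?_, fun a f μ => ?_⟩
  · rw [← muIsometry_coe, ← hU]
  -- Tested against `ζ`, the operator moves to the other side as `star a` and meets only the vector
  -- supported at `μ`, where `apply_muIsometry` applies. No series expansion of `f` is needed.
  · refine ext_inner_left ℂ fun ζ => ?_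
    have hadj : ∀ {E : Type _} [NormedAddCommGroup E] [InnerProductSpace ℂ E] [CompleteSpace E]
        (T : E →L[ℂ] E) (x y : E), inner ℂ x (T y) = inner ℂ (star T x) y := fun T x y => by
      rw [ContinuousLinearMap.star_eq_adjoint, ContinuousLinearMap.adjoint_inner_left]
    rw [← lp.inner_single_left, ← U.inner_map_map, U.apply_symm_apply, hU, hadj, hadj, ← map_star,
      ← map_star]
    change inner ℂ (π (StarSubalgebra.inclusion (eAlg_le_utAlg A) (star a)) _) _ = _
    rw [hπ.apply_muIsometry (hρ μ), ← hU, U.inner_map_map, lp.inner_single_left]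

end DirectSum

/-! ### Injectivity -/

section Separating

/-- Expanding the `t k` in a basis of `M`, each coefficient is an element of `A` killed by the
separating set `W`. An arbitrary bilinear `B` plays the role of the tensor product of `A` and `M`.
-/
theorem sum_apply_apply_eq_zero {κ A M N : Type*} [AddCommGroup A] [Module ℂ A]
    [AddCommGroup M] [Module ℂ M] [AddCommGroup N] [Module ℂ N]
    {W : Set (Module.Dual ℂ A)} (hW : ∀ a, (∀ φ ∈ W, φ a = 0) → a = 0)
    (s : Finset κ) (a : κ → A) (t : κ → M) (h : ∀ φ ∈ W, ∑ k ∈ s, φ (a k) • t k = 0)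
    (B : A →ₗ[ℂ] M →ₗ[ℂ] N) : ∑ k ∈ s, B (a k) (t k) = 0 := by
  classical
  let b := Module.Basis.ofVectorSpace ℂ M
  have h0 : ∀ j, ∑ k ∈ s, b.repr (t k) j • a k = 0 := fun j => hW _ fun φ hφ => by
    have := congrArg (b.coord j) (h φ hφ)
    simpa [mul_comm] using this
  let J := s.biUnion fun k => (b.repr (t k)).support
  have ht : ∀ k ∈ s, t k = ∑ j ∈ J, b.repr (t k) j • b j := fun k hk => by
    conv_lhs => rw [← b.linearCombination_repr (t k)]
    rw [Finsupp.linearCombination_apply]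
    exact Finsupp.sum_of_support_subset _
      (Finset.subset_biUnion_of_mem (fun k => (b.repr (t k)).support) hk) _ (by simp)
  calc ∑ k ∈ s, B (a k) (t k) = ∑ k ∈ s, ∑ j ∈ J, B (b.repr (t k) j • a k) (b j) := by
        refine Finset.sum_congr rfl fun k hk => ?_
        conv_lhs => rw [ht k hk]
        simp
    _ = ∑ j ∈ J, B (∑ k ∈ s, b.repr (t k) j • a k) (b j) := by
        rw [Finset.sum_comm]
        simp
    _ = 0 := by simp [h0]

/-- Products of functionals from separating sets separate finite tensors; one coordinate is peeled
off at a time, with `m` a fixed filling off `F`. -/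
theorem sum_smul_tprod_piecewise_eq_zero [DecidableEq I] {κ : Type*} {A : I → Type*}
    [∀ i, AddCommGroup (A i)] [∀ i, Module ℂ (A i)]
    {W : Π i, Set (Module.Dual ℂ (A i))} (hW : ∀ i a, (∀ φ ∈ W i, φ a = 0) → a = 0)
    (F : Finset I) (s : Finset κ) (c : κ → ℂ) (a : κ → Π i, A i)
    (h : ∀ φ : Π i, Module.Dual ℂ (A i), (∀ i ∈ F, φ i ∈ W i) →
      ∑ k ∈ s, c k * ∏ i ∈ F, φ i (a k i) = 0) (m : Π i, A i) :
    ∑ k ∈ s, c k • PiTensorProduct.tprod ℂ (F.piecewise (a k) m) = 0 := by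
  induction F using Finset.induction_on generalizing c m with
  | empty =>
    have := h 0 (by simp)
    simp only [Finset.prod_empty, mul_one] at this
    simp [← Finset.sum_smul, this]
  | insert i F hi ih =>
    -- Here `M` consists of linear maps out of `A i`: the tensors with slot `i` left open.
    -- `LinearMap.id.flip` is evaluation.
    have key := sum_apply_apply_eq_zero (hW i) s (fun k => a k i)
      (fun k => c k • (PiTensorProduct.tprod ℂ).toLinearMap (F.piecewise (a k) m) i) ?_
      LinearMap.id.flip
    · simpa [Finset.piecewise_insert] using key
    · intro ψ hψ
      ext z
      -- The values of `ψ` are absorbed into the scalars, and `z` fills the open slot.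
      have := ih (fun k => c k * ψ (a k i)) (fun φ hφ => ?_) (Function.update m i z)
      · simpa [Finset.update_piecewise_of_notMem _ _ _ hi, smul_smul, mul_comm] using this
      · rw [← h (Function.update φ i ψ)]
        · refine Finset.sum_congr rfl fun k _ => ?_
          rw [Finset.prod_insert hi, Function.update_self, mul_assoc]
          congr 2
          refine Finset.prod_congr rfl fun j hj => ?_
          rw [Function.update_of_ne (ne_of_mem_of_not_mem hj hi)]
        · intro j hj
          rcases eq_or_ne j i with rfl | hji
          · simpa using hψ
          · rw [Function.update_of_ne hji]
            exact hφ j ((Finset.mem_insert.1 hj).resolve_left hji)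

/-- A complex vector space is not a finite union of proper subspaces, here kernels of nonzero
operators. -/
theorem exists_norm_eq_one_forall_apply_ne_zero {E : Type*} [NormedAddCommGroup E]
    [NormedSpace ℂ E] [Nontrivial E] (s : Set (E →L[ℂ] E)) (hs : s.Finite) :
    ∃ x : E, ‖x‖ = 1 ∧ ∀ T ∈ s, T ≠ 0 → T x ≠ 0 := by
  classical
  let K : Finset (Submodule ℂ E) :=
    -- Including `⊥`, proper since `E` is nontrivial, makes the chosen vector nonzero and so
    -- normalizable.
    insert ⊥ ((hs.toFinset.filter (· ≠ 0)).image fun T : E →L[ℂ] E => LinearMap.ker (T : E →ₗ[ℂ] E))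
  have hK : (⊤ : Submodule ℂ E) ∉ K := by
    simp only [K, Finset.mem_insert, Finset.mem_image, not_or, not_exists,
      not_and]
    refine ⟨top_ne_bot, fun T hT h => (Finset.mem_filter.1 hT).2 ?_⟩
    ext x
    have : x ∈ LinearMap.ker (T : E →ₗ[ℂ] E) := h ▸ Submodule.mem_top
    simpa using this
  obtain ⟨x, hx⟩ := (Set.ne_univ_iff_exists_notMem _).1 (Subspace.biUnion_ne_univ_of_top_notMem hK)
  simp only [Set.mem_iUnion, SetLike.mem_coe, not_exists] at hx
  have hx0 : x ≠ 0 := fun h => hx ⊥ (by simp [K]) (by simp [h])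
  refine ⟨((‖x‖ : ℂ)⁻¹) • x, ?_, fun T hT hT0 h => ?_⟩
  · rw [norm_smul, norm_inv, Complex.norm_real, norm_norm, inv_mul_cancel₀ (norm_ne_zero_iff.2 hx0)]
  · refine hx (LinearMap.ker (T : E →ₗ[ℂ] E)) ?_ ?_
    · refine Finset.mem_insert_of_mem (Finset.mem_image_of_mem _ ?_)
      simpa using ⟨hT, hT0⟩
    · rw [map_smul, smul_eq_zero] at h
      exact h.resolve_left (by simpa using hx0)

end Separating

/-! ### Faithfulness via matrix coefficients -/

section Injective

variable {A : I → Type*} [∀ i, Ring (A i)] [∀ i, StarRing (A i)] [∀ i, Algebra ℂ (A i)]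
  [∀ i, StarModule ℂ (A i)]
  {H : I → Type*} [∀ i, NormedAddCommGroup (H i)] [∀ i, InnerProductSpace ℂ (H i)]
  [∀ i, CompleteSpace (H i)]

/-- The vector functionals of a representation that are given by unit vectors. -/
def vectorFunctionals {B E : Type*} [Ring B] [StarRing B] [Algebra ℂ B] [NormedAddCommGroup E]
    [InnerProductSpace ℂ E] [CompleteSpace E] (ψ : B →⋆ₐ[ℂ] (E →L[ℂ] E)) :
    Set (Module.Dual ℂ B) :=
  {φ | ∃ x y : E, ‖x‖ = 1 ∧ ‖y‖ = 1 ∧ ∀ a, φ a = inner ℂ y (ψ a x)}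

theorem eq_zero_of_forall_vectorFunctionals {B E : Type*} [Ring B] [StarRing B] [Algebra ℂ B]
    [NormedAddCommGroup E] [InnerProductSpace ℂ E] [CompleteSpace E]
    {ψ : B →⋆ₐ[ℂ] (E →L[ℂ] E)} (hψ : Function.Injective ψ) {a : B}
    (h : ∀ φ ∈ vectorFunctionals ψ, φ a = 0) : a = 0 := by
  refine (injective_iff_map_eq_zero ψ).1 hψ a ?_
  have h1 : ∀ x y : E, ‖x‖ = 1 → ‖y‖ = 1 → inner ℂ y (ψ a x) = 0 := fun x y hx hy =>
    h { toFun := fun a => inner ℂ y (ψ a x)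
        map_add' := fun a b => by simp
        map_smul' := fun c a => by simp } ⟨x, y, hx, hy, fun _ => rfl⟩
  ext x
  by_contra hne
  have hx : x ≠ 0 := fun h => hne (by simp [h])
  -- A nonzero `ψ a x` is tested against its own normalization.
  have h2 := h1 (((‖x‖ : ℂ)⁻¹) • x) (((‖ψ a x‖ : ℂ)⁻¹) • ψ a x)
    (by simp [norm_smul, norm_ne_zero_iff.2 hx])
    (by simpa [norm_smul] using inv_mul_cancel₀ (norm_ne_zero_iff.2 hne))
  have hne' : ψ a x ≠ 0 := hne
  rw [map_smul, inner_smul_left, inner_smul_right] at h2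
  simp [hx, hne'] at h2

theorem IsInducedUt.phiForm_eq_zero {Ψ : Π i, A i →⋆ₐ[ℂ] (H i →L[ℂ] H i)}
    {π : utAlg A →⋆ₐ[ℂ] (PhiOneTensor H →L[ℂ] PhiOneTensor H)} (hπ : IsInducedUt Ψ π)
    {a : utAlg A} (ha : π a = 0) {ξ η : ⨂[ℂ] i, H i} (hξ : ξ ∈ unTensor H)
    (hη : η ∈ unTensor H) : phiForm η (tensorRep Ψ a ξ) = 0 := by
  obtain ⟨ζ, hζ, h⟩ := hπ a ⟨ξ, hξ⟩
  have h1 : inner ℂ (((⟨η, hη⟩ : unTensor H)) : PhiOneTensor H) (ζ : PhiOneTensor H) = 0 := by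
    rw [← h, ha, zero_apply, inner_zero_right]
  rw [UniformSpace.Completion.inner_coe] at h1
  rw [← hζ]
  exact h1

theorem sum_eq_zero_of_forall_phiForm [∀ i, Nontrivial (H i)]
    {Ψ : Π i, A i →⋆ₐ[ℂ] (H i →L[ℂ] H i)} (hΨ : ∀ i, Function.Injective (Ψ i))
    {κ : Type*} [Fintype κ] (c : κ → ℂ) (b : κ → Π i, A i)
    (hb : ∀ k, ∀ᶠ i in cofinite, b k i ∈ unitary (A i))
    (h : ∀ ξ ∈ unTensor H, ∀ η ∈ unTensor H,
      phiForm η (tensorRep Ψ (∑ k, c k • PiTensorProduct.tprod ℂ (b k)) ξ) = 0) :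
    ∑ k, c k • PiTensorProduct.tprod ℂ (b k) = 0 := by
  classical
  let s : Setoid κ := (Filter.productSetoid cofinite A).comap b
  have hs : ∀ k l, s k l ↔ ∀ᶠ i in cofinite, b k i = b l i := fun k l => Iff.rfl
  have hev : ∀ᶠ i in cofinite,
      (∀ k, b k i ∈ unitary (A i)) ∧ ∀ k l, s k l → b k i = b l i := by
    refine (eventually_all.2 hb).and (eventually_all.2 fun k => eventually_all.2 fun l => ?_)
    by_cases hkl : s k l
    · exact ((hs k l).1 hkl).mono fun i hi _ => hi
    · exact Eventually.of_forall fun i hi => absurd hi hkl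
  -- Off `F` all `b k i` are unitary and equivalent terms coincide.
  let F := (eventually_cofinite.1 hev).toFinset
  have hF : ∀ i ∉ F, (∀ k, b k i ∈ unitary (A i)) ∧ ∀ k l, s k l → b k i = b l i := fun i hi => by
    by_contra hne
    exact hi ((eventually_cofinite.1 hev).mem_toFinset.2 hne)
  choose z hz1 hz using fun i => exists_norm_eq_one_forall_apply_ne_zero
    (Set.range fun p : κ × κ => Ψ i (b p.1 i - b p.2 i)) (Set.finite_range _)
  have hsep : ∀ i k l, Ψ i (b k i) (z i) = Ψ i (b l i) (z i) → b k i = b l i := fun i k l h => by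
    by_contra hne
    refine hz i (Ψ i (b k i - b l i)) ⟨(k, l), rfl⟩ ?_ ?_
    · rw [map_ne_zero_iff _ (hΨ i)]
      exact sub_ne_zero.2 hne
    · rw [map_sub, sub_apply, h, sub_self]
  -- Each class cancels by itself; off `F` its members all equal `b l`, which serves as the filling.
  refine Finset.sum_cancels_of_partition_cancels s fun l _ => ?_
  have key := sum_smul_tprod_piecewise_eq_zero (W := fun i => vectorFunctionals (Ψ i))
    (fun i a ha => eq_zero_of_forall_vectorFunctionals (hΨ i) ha) F
    (Finset.univ.filter fun k => s k l) c b ?_ (b l)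
  · rw [← key]
    refine Finset.sum_congr rfl fun k hk => ?_
    congr 2
    ext i
    by_cases hi : i ∈ F
    · rw [Finset.piecewise_eq_of_mem _ _ _ hi]
    · rw [Finset.piecewise_eq_of_notMem _ _ _ hi]
      exact (hF i hi).2 k l (Finset.mem_filter.1 hk).2
  · intro φ hφ
    have hnorm : ∀ i ∉ F, ∀ k, ‖Ψ i (b k i) (z i)‖ = 1 := fun i hi k => by
      rw [ContinuousLinearMap.norm_map_of_mem_unitary (Unitary.map_mem (Ψ i) ((hF i hi).1 k)), hz1]
    -- Test vectors: on `F` those that define `φ i`, off `F` the vector `z i` and its image under `b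
    -- l i`.
    have hxy : ∀ i, ∃ x y : H i, ‖x‖ = 1 ∧ ‖y‖ = 1 ∧
        (i ∈ F → ∀ a, φ i a = inner ℂ y (Ψ i a x)) ∧
        (i ∉ F → x = z i ∧ y = Ψ i (b l i) (z i)) := fun i => by
      by_cases hi : i ∈ F
      · obtain ⟨x, y, hx, hy, h⟩ := hφ i hi
        exact ⟨x, y, hx, hy, fun _ => h, fun h => absurd hi h⟩
      · exact ⟨z i, Ψ i (b l i) (z i), hz1 i, hnorm i hi l, fun h => absurd h hi,
          fun _ => ⟨rfl, rfl⟩⟩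
    choose x y hx hy hxyF hxyF' using hxy
    have hone : ∀ i ∉ F, ∀ k, inner ℂ (y i) (Ψ i (b k i) (x i)) = 1 ↔ b k i = b l i :=
      fun i hi k => by
        rw [(hxyF' i hi).1, (hxyF' i hi).2,
          inner_eq_one_iff_of_norm_eq_one (hnorm i hi l) (hnorm i hi k)]
        exact ⟨fun h => (hsep i l k h).symm, fun h => by rw [h]⟩
    -- By `hone` the inner products are 1 almost everywhere exactly for `k` equivalent to `l`, and
    -- then all factors off `F` are 1.
    have hterm : ∀ k, phiForm (PiTensorProduct.tprod ℂ y)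
        (PiTensorProduct.tprod ℂ fun i => Ψ i (b k i) (x i)) =
          if s k l then ∏ i ∈ F, φ i (b k i) else 0 := fun k => by
      have hiff : (∀ᶠ i in cofinite, inner ℂ (y i) (Ψ i (b k i) (x i)) = 1) ↔ s k l := by
        rw [hs]
        refine eventually_congr ?_
        filter_upwards [F.eventually_cofinite_notMem] with i hi using hone i hi k
      rw [phiForm_tprod]
      simp only [hiff]
      split_ifs with hkl
      · rw [finprod_eq_prod_of_mulSupport_subset (s := F) _ fun i hi => ?_]
        · exact Finset.prod_congr rfl fun i hi => (hxyF i hi (b k i)).symm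
        · by_contra hiF
          exact hi ((hone i hiF k).2 ((hF i hiF).2 k l hkl))
      · rfl
    have h0 := h (PiTensorProduct.tprod ℂ x) (Submodule.subset_span
      ⟨x, fun i => mem_sphere_zero_iff_norm.2 (hx i), rfl⟩) (PiTensorProduct.tprod ℂ y)
      (Submodule.subset_span ⟨y, fun i => mem_sphere_zero_iff_norm.2 (hy i), rfl⟩)
    rw [← h0, map_sum, LinearMap.sum_apply, Finset.sum_filter]
    simp only [phiForm, map_sum]
    refine Finset.sum_congr rfl fun k _ => ?_
    rw [map_smul, LinearMap.smul_apply, tensorRep_tprod, ← phiForm, phiForm_smul_right, hterm]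
    split_ifs <;> simp

theorem IsInducedUt.injective {Ψ : Π i, A i →⋆ₐ[ℂ] (H i →L[ℂ] H i)}
    {π : utAlg A →⋆ₐ[ℂ] (PhiOneTensor H →L[ℂ] PhiOneTensor H)} (hπ : IsInducedUt Ψ π)
    (hΨ : ∀ i, Function.Injective (Ψ i)) : Function.Injective π := by
  rw [injective_iff_map_eq_zero]
  rintro ⟨a, ha⟩ h0
  refine Subtype.ext ?_
  change a = 0
  by_cases hH : ∀ i, Nontrivial (H i)
  · obtain ⟨n, c, g, rfl⟩ := Submodule.mem_span_set'.1 ((mem_utAlg_iff a).1 ha)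
    choose b hb hbg using fun k => (g k).2
    simp only [← hbg] at h0 ⊢
    exact sum_eq_zero_of_forall_phiForm hΨ c b hb fun ξ hξ η hη => hπ.phiForm_eq_zero h0 hξ hη
  -- If some `H i` is zero, the hypothesis on `π` carries no information; instead injectivity of `Ψ
  -- i` forces `A i`, hence the whole tensor product, to vanish.
  · push Not at hH
    obtain ⟨i, hi⟩ := hH
    clear ha h0
    induction a using PiTensorProduct.induction_on with
    | smul_tprod r m =>
      rw [MultilinearMap.map_coord_zero _ i (hΨ i (Subsingleton.elim _ _)), smul_zero]
    | add x y hx hy => rw [hx, hy, add_zero]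

end Injective

end InfTensor

end

theorem mainTheorem2 {I : Type*} [Infinite I]
    {A : I → Type*} [∀ i, Ring (A i)] [∀ i, StarRing (A i)] [∀ i, Algebra ℂ (A i)]
    [∀ i, StarModule ℂ (A i)]
    {H : I → Type*} [∀ i, NormedAddCommGroup (H i)] [∀ i, InnerProductSpace ℂ (H i)]
    [∀ i, CompleteSpace (H i)]
    (Ψ : Π i, A i →⋆ₐ[ℂ] (H i →L[ℂ] H i)) :
    (∃! π : InfTensor.utAlg A →⋆ₐ[ℂ]
        (InfTensor.PhiOneTensor H →L[ℂ] InfTensor.PhiOneTensor H),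
      InfTensor.IsInducedUt Ψ π) ∧
    (∀ μ : InfTensor.UnClass H,
      ∃! ρ : InfTensor.eAlg A →⋆ₐ[ℂ] (InfTensor.MuTensor μ →L[ℂ] InfTensor.MuTensor μ),
        InfTensor.IsInducedE Ψ μ ρ) ∧
    ∀ π : InfTensor.utAlg A →⋆ₐ[ℂ]
        (InfTensor.PhiOneTensor H →L[ℂ] InfTensor.PhiOneTensor H),
      InfTensor.IsInducedUt Ψ π →
        (∀ ρ : Π μ : InfTensor.UnClass H,
            InfTensor.eAlg A →⋆ₐ[ℂ] (InfTensor.MuTensor μ →L[ℂ] InfTensor.MuTensor μ),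
          (∀ μ, InfTensor.IsInducedE Ψ μ (ρ μ)) → InfTensor.IsDirectSum π ρ) ∧
        ((∀ i, Function.Injective (Ψ i)) → Function.Injective π) :=
  ⟨InfTensor.existsUnique_isInducedUt Ψ, InfTensor.existsUnique_isInducedE Ψ,
    fun _ hπ => ⟨fun _ hρ => hπ.isDirectSum hρ, hπ.injective⟩⟩
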